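/- Consider $N$ subsystems with the same finite number $d$ of levels, with Hilbert space $\mathcal H=(\mathbb C^d)^{\otimes N}$, and the Liouvillian $$\mathcal L[\rho]=-\mathrm i[H,\rho]+\sum_\mu\left(2L_\mu\rho L_\mu^\dagger-\{L_\mu^\dagger L_\mu,\rho\}\right),$$ with $H$ Hermitian and finitely many jump operators $L_\mu$. For an operator $X$ on $\mathcal H$ and an initial density operator $\rho_0$ write $\langle X(t)\rangle=\operatorname{tr}(X e^{t\mathcal L}\rho_0)$, and $X(t)=e^{t\mathcal L^\dagger}X$ (Heisenberg picture). For an operator $O$ on $\mathbb C^d$ let $O_j$ be $O$ acting on subsystem $j$. Let $P_{j,k}$ be an operator exchanging the subsystems $j$ and $k$, i.e. the permutation operator of an involution of the subsystems that maps $j$ to $k$ (for example the transposition of $j$ and $k$, or a reflection). Say that $(A,\rho_\infty,\lambda)$ is a mode if $A$ is unitary, $\rho_\infty$ is a density operator with $\mathcal L[\rho_\infty]=0$, $\lambda\in\mathbb R$, and $$[L_\mu,A]\rho_\infty=0\ \ \forall\mu,\qquad \Big(-\mathrm i[H,A]-\sum_\mu[L_\mu^\dagger,A]L_\mu\Big)\rho_\infty=\mathrm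 i\lambda A\rho_\infty .$$ Say that all modes commute with an operator $P$ if $[P,A]\rho_\infty=0$ for every mode $(A,\rho_\infty,\lambda)$ (including those with $\lambda=0$); this holds in particular if every such $A$ commutes with $P$. Subsystems $j,k$ are stably synchronized in $O$ if for some initial state $\langle O_j(t)\rangle=\langle O_k(t)\rangle+\mathcal O(e^{-\gamma t})$ as $t\to\infty$ for some $\gamma>0$, and $\langle O_j(t)\rangle$ does not converge as $t\to\infty$ (it does not become stationary). They are robustly and stably synchronized in $O$, with respect to $P_{j,k}$, if moreover, again up to terms exponentially small in time, $O_j(t)=P_{j,k}O_k(t)P_{j,k}$ and $\langle O_j(t)\rangle=\langle O_k(t)\rangle$ for every initial state, and the operator $O_j(t)$ does not converge as $t\to\infty$. Suppose that $\mathcal L$ is unital, $\mathcal L[\mathbb 1]=0$, and that there is a mode $(A,\rho_\infty,\lambda)$ with $\lambda\neq0$ and $\operatorname{tr}(O_jA\rho_\infty)\ne0$. 1. If all modes commute with $P_{j,k}$, then the subsystems $j$ and $k$ are robustly and stably synchronized in $O$ with respect to $P_{j,k}$. 2. If all modes are translation invariant, i.e. for every pair of neighbours $i,i+1$ all modes commute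 with the operator that swaps the subsystems $i$ and $i+1$, then any two distinct subsystems $a,b$ are robustly and stably synchronized in $O$, with respect to the operator that swaps $a$ and $b$. -/

import Mathlib

namespace QuantumSync

open Filter Topology Asymptotics
open scoped Matrix ComplexOrder

/-- Operators on the Hilbert space `(ℂ^d)^{⊗ N}` of `N` subsystems with `d` levels each, written
in the product basis, which is labelled by the configurations `Fin N → Fin d`. -/
abbrev Op (N d : ℕ) : Type := Matrix (Fin N → Fin d) (Fin N → Fin d) ℂ

/-- The local operator `O_j = 1 ⊗ ⋯ ⊗ O ⊗ ⋯ ⊗ 1`, with `O` acting on subsystem `j`. -/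
def localOp {N d : ℕ} (O : Matrix (Fin d) (Fin d) ℂ) (j : Fin N) : Op N d :=
  Matrix.of fun s s' => if ∀ i, i ≠ j → s i = s' i then O (s j) (s' j) else 0

/-- The operator that permutes the subsystems according to `π`; it sends the basis vector
labelled by `s'` to the one labelled by `s' ∘ π`. For an involution `π` with `π j = k` it is an
operator exchanging subsystems `j` and `k`, with square `1`. -/
def permOp {N : ℕ} (d : ℕ) (π : Equiv.Perm (Fin N)) : Op N d :=
  Matrix.of fun s s' => if s = s' ∘ π then 1 else 0

/-- The exchange operator `P_{j,k}` that swaps subsystems `j` and `k` and nothing else. -/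
def swapOp {N : ℕ} (d : ℕ) (j k : Fin N) : Op N d := permOp d (Equiv.swap j k)

/-- The Liouvillian
`ρ ↦ -i[H, ρ] + ∑ μ, (2 L_μ ρ L_μ† - {L_μ† L_μ, ρ})` (Schrödinger picture). -/
def liouvillian {N d : ℕ} {ι : Type*} [Fintype ι] (H : Op N d) (L : ι → Op N d) :
    Op N d →ₗ[ℂ] Op N d where
  toFun ρ := (-Complex.I) • (H * ρ - ρ * H) +
    ∑ μ, ((2 : ℂ) • (L μ * ρ * (L μ)ᴴ) - ((L μ)ᴴ * L μ * ρ + ρ * ((L μ)ᴴ * L μ)))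
  map_add' X Y := by
    have h : ∀ μ, (2 : ℂ) • (L μ * (X + Y) * (L μ)ᴴ)
          - ((L μ)ᴴ * L μ * (X + Y) + (X + Y) * ((L μ)ᴴ * L μ))
        = ((2 : ℂ) • (L μ * X * (L μ)ᴴ) - ((L μ)ᴴ * L μ * X + X * ((L μ)ᴴ * L μ)))
          + ((2 : ℂ) • (L μ * Y * (L μ)ᴴ) - ((L μ)ᴴ * L μ * Y + Y * ((L μ)ᴴ * L μ))) := by
      intro μ
      simp only [mul_add, add_mul, smul_add]
      abel
    rw [Finset.sum_congr rfl fun μ _ => h μ, Finset.sum_add_distrib, mul_add, add_mul,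
      add_sub_add_comm, smul_add]
    abel
  map_smul' c X := by
    simp only [Matrix.mul_smul, Matrix.smul_mul, RingHom.id_apply, smul_add, Finset.smul_sum,
      smul_sub, smul_comm c (2 : ℂ), smul_comm c (-Complex.I)]

/-- The Hilbert-Schmidt adjoint of the Liouvillian, which generates the Heisenberg picture:
`X ↦ i[H, X] + ∑ μ, (2 L_μ† X L_μ - {L_μ† L_μ, X})`. -/
def heisenbergGenerator {N d : ℕ} {ι : Type*} [Fintype ι] (H : Op N d) (L : ι → Op N d) :
    Op N d →ₗ[ℂ] Op N d where
  toFun X := Complex.I • (H * X - X * H) +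
    ∑ μ, ((2 : ℂ) • ((L μ)ᴴ * X * L μ) - ((L μ)ᴴ * L μ * X + X * ((L μ)ᴴ * L μ)))
  map_add' X Y := by
    have h : ∀ μ, (2 : ℂ) • ((L μ)ᴴ * (X + Y) * L μ)
          - ((L μ)ᴴ * L μ * (X + Y) + (X + Y) * ((L μ)ᴴ * L μ))
        = ((2 : ℂ) • ((L μ)ᴴ * X * L μ) - ((L μ)ᴴ * L μ * X + X * ((L μ)ᴴ * L μ)))
          + ((2 : ℂ) • ((L μ)ᴴ * Y * L μ) - ((L μ)ᴴ * L μ * Y + Y * ((L μ)ᴴ * L μ))) := by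
      intro μ
      simp only [mul_add, add_mul, smul_add]
      abel
    rw [Finset.sum_congr rfl fun μ _ => h μ, Finset.sum_add_distrib, mul_add, add_mul,
      add_sub_add_comm, smul_add]
    abel
  map_smul' c X := by
    simp only [Matrix.mul_smul, Matrix.smul_mul, RingHom.id_apply, smul_add, Finset.smul_sum,
      smul_sub, smul_comm c (2 : ℂ), smul_comm c Complex.I]

/-- The exponential `e^{t G}` of a superoperator `G`, applied to the operator `X`. The exponential
is taken of the matrix of `G` in the basis of matrix units. -/
noncomputable def evolve {N d : ℕ} (G : Op N d →ₗ[ℂ] Op N d) (t : ℝ) (X : Op N d) : Op N d :=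
  let b := Matrix.stdBasis ℂ (Fin N → Fin d) (Fin N → Fin d)
  Matrix.toLin b b (NormedSpace.exp ((t : ℂ) • LinearMap.toMatrix b b G)) X

/-- Density operators, the states of the system. -/
def IsState {N d : ℕ} (ρ : Op N d) : Prop := ρ.PosSemidef ∧ ρ.trace = 1

/-- The expectation value `⟨X(t)⟩ = tr (X e^{t ℒ} ρ₀)` for the initial state `ρ₀`. -/
noncomputable def expectation {N d : ℕ} {ι : Type*} [Fintype ι] (H : Op N d) (L : ι → Op N d)
    (ρ₀ X : Op N d) (t : ℝ) : ℂ :=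
  (X * evolve (liouvillian H L) t ρ₀).trace

/-- The operator `X(t) = e^{t ℒ†} X` in the Heisenberg picture. -/
noncomputable def heisenberg {N d : ℕ} {ι : Type*} [Fintype ι] (H : Op N d) (L : ι → Op N d)
    (X : Op N d) (t : ℝ) : Op N d :=
  evolve (heisenbergGenerator H L) t X

/-- `f` and `g` are equal after a transient, up to terms that are exponentially small in time. -/
def EventuallySame (f g : ℝ → ℂ) : Prop :=
  ∃ γ : ℝ, 0 < γ ∧ (fun t => f t - g t) =O[atTop] fun t => Real.exp (-γ * t)

/-- Stable synchronization of the subsystems `j` and `k` in `O`: for some initial state the two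
signals agree after a transient (up to exponentially small terms), for all later times, and do
not become stationary (they do not converge, so they are not constant up to decaying terms). -/
def StablySynchronized {N d : ℕ} {ι : Type*} [Fintype ι] (H : Op N d) (L : ι → Op N d)
    (O : Matrix (Fin d) (Fin d) ℂ) (j k : Fin N) : Prop :=
  ∃ ρ₀ : Op N d, IsState ρ₀ ∧
    EventuallySame (expectation H L ρ₀ (localOp O j)) (expectation H L ρ₀ (localOp O k)) ∧
    ¬ ∃ c : ℂ, Tendsto (expectation H L ρ₀ (localOp O j)) atTop (𝓝 c)

/-- Robust and stable synchronization of the subsystems `j` and `k` in `O`, with respect to an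
operator `P` that exchanges `j` and `k`: they are stably synchronized, and, in the Heisenberg
picture and up to exponentially small terms, `O_j(t) = P O_k(t) P`, while `O_j(t)` does not become
stationary. The middle clause is the purpose of the notion: whatever the initial state, the two
signals become equal. -/
def RobustlyStablySynchronized {N d : ℕ} {ι : Type*} [Fintype ι] (H : Op N d) (L : ι → Op N d)
    (O : Matrix (Fin d) (Fin d) ℂ) (P : Op N d) (j k : Fin N) : Prop :=
  StablySynchronized H L O j k ∧
  (∀ ρ₀ : Op N d, IsState ρ₀ →
    EventuallySame (expectation H L ρ₀ (localOp O j)) (expectation H L ρ₀ (localOp O k))) ∧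
  (∀ s s', EventuallySame (fun t => heisenberg H L (localOp O j) t s s')
    (fun t => (P * heisenberg H L (localOp O k) t * P) s s')) ∧
  ¬ ∃ X : Op N d, ∀ s s',
    Tendsto (fun t => heisenberg H L (localOp O j) t s s') atTop (𝓝 (X s s'))

/-- A (proper) non-equilibrium steady state: a density operator annihilated by `ℒ`. -/
def IsNESS {N d : ℕ} {ι : Type*} [Fintype ι] (H : Op N d) (L : ι → Op N d)
    (ρ : Op N d) : Prop :=
  IsState ρ ∧ liouvillian H L ρ = 0

/-- The conditions on a unitary `A`, a steady state `ρ` and a real number `lam` under which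
`A ρ` is an eigenoperator of `ℒ` with eigenvalue `i lam`:
`[L_μ, A] ρ = 0` for all `μ`, and `(-i[H, A] - ∑ μ, [L_μ†, A] L_μ) ρ = i lam A ρ`. -/
structure IsMode {N d : ℕ} {ι : Type*} [Fintype ι] (H : Op N d) (L : ι → Op N d)
    (A ρ : Op N d) (lam : ℝ) : Prop where
  unitary : A ∈ Matrix.unitaryGroup (Fin N → Fin d) ℂ
  ness : IsNESS H L ρ
  jump : ∀ μ, (L μ * A - A * L μ) * ρ = 0
  freq : ((-Complex.I) • (H * A - A * H) - ∑ μ, ((L μ)ᴴ * A - A * (L μ)ᴴ) * L μ) * ρ =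
    (Complex.I * (lam : ℂ)) • (A * ρ)

/-- Every `A` that fulfils the conditions above commutes with `P`. These conditions fix `A` only
on the range of the corresponding steady state `ρ` (off the range `A` is an arbitrary unitary
completion), so the commutator is required to vanish there: `[P, A] ρ = 0`. This is implied by
`[P, A] = 0`. -/
def AllModesCommute {N d : ℕ} {ι : Type*} [Fintype ι] (H : Op N d) (L : ι → Op N d)
    (P : Op N d) : Prop :=
  ∀ (A ρ : Op N d) (lam : ℝ), IsMode H L A ρ lam → (P * A - A * P) * ρ = 0

end QuantumSync

namespace QuantumSync

open Filter Topology Asymptotics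
open scoped Matrix ComplexOrder

/-! ### Exponentials of superoperators -/

section Evolution

variable {N d : ℕ}

/-! Let G be the Heisenberg generator. Unitality means that G annihilates the trace, so the trace of
the dissipation identity for X†X reads Re tr(X† G X) = -∑ ‖[L_μ, X]‖² in the Hilbert-Schmidt norm.
Hence no eigenvalue of G has positive real part, and an eigenoperator with imaginary eigenvalue iλ
commutes with every L_μ. As X† is an eigenoperator too, X also commutes with every L_μ†, and then
[H, X] = λX. Such X (`IsPeripheral`) are eigenoperators of both G and ℒ, which forces imaginary
eigenvalues to be semisimple. So every operator is the sum of an exponentially decaying and a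
peripheral part (`decaySubmodule_sup_peripheralSubmodule`), and it decays as soon as its trace
pairing with all peripheral operators vanishes.

Peripheral operators are modes in disguise: in the polar decomposition X = AB, the modulus B =
√(X†X) is peripheral of frequency 0, and A with the normalized B is a mode. If all modes commute
with P, then P commutes with all peripheral X (`AllModesCommute.commute`). Conjugation by P takes
O_k to O_j, so both have the same pairing with every peripheral operator and O_j - O_k decays. The
given mode provides a peripheral Y whose pairing with O_j(t) rotates forever, so O_j(t) cannot
converge. -/

theorem hasSum_evolve (G : Op N d →ₗ[ℂ] Op N d) (t : ℝ) (X : Op N d) :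
    HasSum (fun n : ℕ => ((n.factorial : ℂ)⁻¹ * (t : ℂ) ^ n) • (G ^ n) X) (evolve G t X) := by
  let b := Matrix.stdBasis ℂ (Fin N → Fin d) (Fin N → Fin d)
  let M := LinearMap.toMatrix b b G
  have h : HasSum (fun n : ℕ => ((n.factorial : ℂ)⁻¹) • ((t : ℂ) • M) ^ n)
      (NormedSpace.exp ((t : ℂ) • M)) := by
    open scoped Matrix.Norms.Operator in
    exact NormedSpace.exp_series_hasSum_exp' ((t : ℂ) • M)
  let Φ : Matrix ((Fin N → Fin d) × (Fin N → Fin d)) ((Fin N → Fin d) × (Fin N → Fin d)) ℂ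
      →ₗ[ℂ] Op N d :=
    (LinearMap.applyₗ X).comp (Matrix.toLin b b).toLinearMap
  have hΦ : Continuous Φ := LinearMap.continuous_of_finiteDimensional Φ
  have h2 := h.map Φ hΦ
  refine (h2.congr_fun ?_)
  intro n
  have hM : Matrix.toLin b b (M ^ n) = G ^ n := by
    change Matrix.toLinAlgEquiv b (LinearMap.toMatrixAlgEquiv b G ^ n) = _
    rw [map_pow, Matrix.toLinAlgEquiv_toMatrixAlgEquiv]
  simp only [Function.comp, smul_pow, map_smul]
  have : Φ (M ^ n) = (G ^ n) X := by
    change Matrix.toLin b b (M ^ n) X = _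
    rw [hM]
  rw [this, smul_smul]

theorem evolve_add (G : Op N d →ₗ[ℂ] Op N d) (t : ℝ) (X Y : Op N d) :
    evolve G t (X + Y) = evolve G t X + evolve G t Y := map_add _ X Y

theorem evolve_sub (G : Op N d →ₗ[ℂ] Op N d) (t : ℝ) (X Y : Op N d) :
    evolve G t (X - Y) = evolve G t X - evolve G t Y := map_sub _ X Y

theorem evolve_smul (G : Op N d →ₗ[ℂ] Op N d) (t : ℝ) (c : ℂ) (X : Op N d) :
    evolve G t (c • X) = c • evolve G t X := map_smul _ c X

theorem evolve_zero (G : Op N d →ₗ[ℂ] Op N d) (t : ℝ) : evolve G t 0 = 0 := by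
  simpa using evolve_smul G t 0 0

theorem evolve_of_pow_eq_zero (G : Op N d →ₗ[ℂ] Op N d) (t : ℝ) (X : Op N d) (k : ℕ)
    (h : (G ^ k) X = 0) :
    evolve G t X =
      ∑ n ∈ Finset.range k, ((n.factorial : ℂ)⁻¹ * (t : ℂ) ^ n) • (G ^ n) X := by
  refine (hasSum_evolve G t X).unique (hasSum_sum_of_ne_finset_zero fun n hn => ?_)
  obtain ⟨m, rfl⟩ := Nat.exists_eq_add_of_le (not_lt.mp (fun h => hn (Finset.mem_range.mpr h)))
  rw [add_comm k m, pow_add G, Module.End.mul_apply, h, map_zero, smul_zero]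

/-- The scalar part commutes with the rest. On a generalized eigenvector for c the remaining
exponential series terminates, so the evolution is a polynomial times an exponential. -/
theorem evolve_shift (G : Op N d →ₗ[ℂ] Op N d) (c : ℂ) (t : ℝ) (X : Op N d) :
    evolve G t X = Complex.exp (t * c) •
      evolve (G - algebraMap ℂ (Module.End ℂ (Op N d)) c) t X := by
  let b := Matrix.stdBasis ℂ (Fin N → Fin d) (Fin N → Fin d)
  let K := G - algebraMap ℂ (Module.End ℂ (Op N d)) c
  have hG : (t : ℂ) • LinearMap.toMatrix b b G =
      (t : ℂ) • LinearMap.toMatrix b b K + ((t : ℂ) * c) • 1 := by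
    have : LinearMap.toMatrix b b G = LinearMap.toMatrix b b K + c • 1 := by
      rw [← LinearMap.toMatrix_one b, ← map_smul, ← map_add]
      congr 1
      simp [K, Algebra.algebraMap_eq_smul_one]
    rw [this, smul_add, smul_smul]
  have hexp : NormedSpace.exp (((t : ℂ) * c) • (1 : Matrix ((Fin N → Fin d) × (Fin N → Fin d))
      ((Fin N → Fin d) × (Fin N → Fin d)) ℂ)) = Complex.exp (t * c) • 1 := by
    rw [← Matrix.diagonal_one, ← Matrix.diagonal_smul, Matrix.exp_diagonal,
      ← Matrix.diagonal_smul]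
    congr 1
    ext i
    simp [NormedSpace.exp_eq_tsum_div, Complex.exp_eq_exp_ℂ]
  change Matrix.toLin b b (NormedSpace.exp ((t : ℂ) • LinearMap.toMatrix b b G)) X =
    _ • Matrix.toLin b b (NormedSpace.exp ((t : ℂ) • LinearMap.toMatrix b b K)) X
  rw [hG, Matrix.exp_add_of_commute _ _ ((Commute.one_right _).smul_right _), hexp,
    Matrix.mul_smul, mul_one, map_smul, LinearMap.smul_apply]

theorem evolve_of_eigen (G : Op N d →ₗ[ℂ] Op N d) (c : ℂ) (t : ℝ) (X : Op N d)
    (h : G X = c • X) : evolve G t X = Complex.exp (t * c) • X := by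
  rw [evolve_shift G c, evolve_of_pow_eq_zero _ t X 1 (by simp [h, Algebra.algebraMap_eq_smul_one])]
  simp

theorem trace_mul_evolve (G G' : Op N d →ₗ[ℂ] Op N d)
    (h : ∀ X Y, (X * G Y).trace = (G' X * Y).trace) (t : ℝ) (X Y : Op N d) :
    (X * evolve G t Y).trace = (evolve G' t X * Y).trace := by
  have hp : ∀ n : ℕ, ∀ X Y, (X * (G ^ n) Y).trace = ((G' ^ n) X * Y).trace := by
    intro n
    induction n with
    | zero => simp
    | succ n ih =>
      intro X Y
      rw [pow_succ' G, pow_succ G', Module.End.mul_apply, Module.End.mul_apply, h, ih]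
  have h1 := (hasSum_evolve G t Y).map
    ((Matrix.traceLinearMap _ ℂ ℂ).comp (LinearMap.mulLeft ℂ X))
    (LinearMap.continuous_of_finiteDimensional _)
  have h2 := (hasSum_evolve G' t X).map
    ((Matrix.traceLinearMap _ ℂ ℂ).comp (LinearMap.mulRight ℂ Y))
    (LinearMap.continuous_of_finiteDimensional _)
  refine h1.unique (h2.congr_fun fun n => ?_)
  simp [hp]

end Evolution

/-! ### Exponentially decaying operators -/

section Decay

/-- `f` tends to zero at least exponentially fast. -/
def DecaysExponentially (f : ℝ → ℂ) : Prop :=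
  ∃ γ : ℝ, 0 < γ ∧ f =O[atTop] fun t => Real.exp (-γ * t)

theorem isBigO_exp_neg_of_le {γ γ' : ℝ} (h : γ ≤ γ') :
    (fun t : ℝ => Real.exp (-γ' * t)) =O[atTop] fun t => Real.exp (-γ * t) := by
  refine IsBigO.of_bound 1 ?_
  filter_upwards [eventually_ge_atTop 0] with t ht
  rw [one_mul, Real.norm_eq_abs, Real.norm_eq_abs, Real.abs_exp, Real.abs_exp]
  exact Real.exp_le_exp.mpr (by nlinarith)

namespace DecaysExponentially

theorem zero : DecaysExponentially fun _ => 0 := ⟨1, one_pos, isBigO_zero _ _⟩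

theorem add {f g : ℝ → ℂ} (hf : DecaysExponentially f) (hg : DecaysExponentially g) :
    DecaysExponentially (fun t => f t + g t) := by
  obtain ⟨a, ha, hfa⟩ := hf
  obtain ⟨b, hb, hgb⟩ := hg
  exact ⟨min a b, lt_min ha hb, (hfa.trans (isBigO_exp_neg_of_le (min_le_left a b))).add
    (hgb.trans (isBigO_exp_neg_of_le (min_le_right a b)))⟩

theorem const_mul {f : ℝ → ℂ} (hf : DecaysExponentially f) (c : ℂ) :
    DecaysExponentially (fun t => c * f t) := by
  obtain ⟨a, ha, hfa⟩ := hf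
  exact ⟨a, ha, hfa.const_mul_left c⟩

theorem sub {f g : ℝ → ℂ} (hf : DecaysExponentially f) (hg : DecaysExponentially g) :
    DecaysExponentially (fun t => f t - g t) := by
  simpa [sub_eq_add_neg] using hf.add (hg.const_mul (-1))

theorem sum {ι : Type*} (s : Finset ι) {f : ι → ℝ → ℂ}
    (hf : ∀ i ∈ s, DecaysExponentially (f i)) :
    DecaysExponentially (fun t => ∑ i ∈ s, f i t) := by
  classical
  induction s using Finset.induction_on with
  | empty => simpa using zero
  | insert a s ha ih =>
    simp only [Finset.sum_insert ha]
    exact (hf a (Finset.mem_insert_self a s)).add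
      (ih fun i hi => hf i (Finset.mem_insert_of_mem hi))

theorem tendsto {f : ℝ → ℂ} (hf : DecaysExponentially f) : Tendsto f atTop (𝓝 0) := by
  obtain ⟨a, ha, hfa⟩ := hf
  refine hfa.trans_tendsto (Real.tendsto_exp_atBot.comp ?_)
  exact tendsto_id.const_mul_atTop_of_neg (neg_lt_zero.mpr ha)

theorem pow_mul_exp (n : ℕ) {c : ℂ} (hc : c.re < 0) :
    DecaysExponentially (fun t : ℝ => (t : ℂ) ^ n * Complex.exp (t * c)) := by
  -- Half of the decay rate is spent on absorbing the polynomial factor.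
  refine ⟨-c.re / 2, by linarith, ?_⟩
  have h := (isLittleO_pow_exp_pos_mul_atTop n (b := -c.re / 2) (by linarith)).isBigO
  have h' := h.mul (isBigO_refl (fun t : ℝ => Real.exp (t * c.re)) atTop)
  refine (IsBigO.of_norm_left ?_)
  refine (h'.norm_left.congr (fun t => ?_) fun t => ?_)
  · simp [Complex.norm_exp]
  · rw [← Real.exp_add]
    congr 1
    ring

end DecaysExponentially

variable {N d : ℕ}

/-- The operators whose evolution under `e^{t G}` decays exponentially. -/
def decaySubmodule (G : Op N d →ₗ[ℂ] Op N d) : Submodule ℂ (Op N d) where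
  carrier := {X | ∀ s s', DecaysExponentially fun t => evolve G t X s s'}
  zero_mem' := fun s s' => by simpa [evolve_zero] using DecaysExponentially.zero
  add_mem' hX hY s s' := by simpa [evolve_add] using (hX s s').add (hY s s')
  smul_mem' c X hX s s' := by simpa [evolve_smul] using (hX s s').const_mul c

theorem decays_mul_mul {F : ℝ → Op N d} (hF : ∀ s s', DecaysExponentially fun t => F t s s')
    (Y Z : Op N d) (s s' : Fin N → Fin d) :
    DecaysExponentially (fun t => (Y * F t * Z) s s') := by
  simp only [Matrix.mul_apply, Finset.sum_mul]
  refine DecaysExponentially.sum _ fun i _ => DecaysExponentially.sum _ fun k _ => ?_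
  simpa [mul_comm, mul_assoc, mul_left_comm] using (hF k i).const_mul (Y s k * Z i s')

theorem decays_trace_mul {F : ℝ → Op N d} (hF : ∀ s s', DecaysExponentially fun t => F t s s')
    (Y : Op N d) : DecaysExponentially (fun t => (Y * F t).trace) := by
  simp only [Matrix.trace, Matrix.diag_apply]
  refine DecaysExponentially.sum _ fun i _ => ?_
  simpa using decays_mul_mul hF Y 1 i i

theorem mem_decaySubmodule_of_pow_eq_zero (G : Op N d →ₗ[ℂ] Op N d) {c : ℂ} (hc : c.re < 0)
    (k : ℕ) (X : Op N d)
    (h : ((G - algebraMap ℂ (Module.End ℂ (Op N d)) c) ^ k) X = 0) :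
    X ∈ decaySubmodule G := by
  intro s s'
  simp only [evolve_shift G c, evolve_of_pow_eq_zero _ _ X k h, Matrix.smul_apply,
    Matrix.sum_apply, smul_eq_mul, Finset.mul_sum]
  refine DecaysExponentially.sum _ fun n _ => ?_
  have := (DecaysExponentially.pow_mul_exp n hc).const_mul ((n.factorial : ℂ)⁻¹ *
    ((G - algebraMap ℂ (Module.End ℂ (Op N d)) c) ^ n) X s s')
  refine cast ?_ this
  congr 1
  ext t
  ring

end Decay

/-! ### The algebra of peripheral operators -/

section Peripheral

variable {N d : ℕ} {ι : Type*} {H : Op N d} {L : ι → Op N d}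

/-- An operator that commutes with all jump operators and their adjoints and is an eigenoperator
of `[H, ·]` with eigenvalue `lam`. -/
structure IsPeripheral (H : Op N d) (L : ι → Op N d) (lam : ℝ) (X : Op N d) : Prop where
  jump : ∀ μ, L μ * X = X * L μ
  jump_adj : ∀ μ, (L μ)ᴴ * X = X * (L μ)ᴴ
  freq : H * X - X * H = (lam : ℂ) • X

namespace IsPeripheral

variable {lam lam' : ℝ} {X Y : Op N d}

theorem mul (h : IsPeripheral H L lam X) (h' : IsPeripheral H L lam' Y) :
    IsPeripheral H L (lam + lam') (X * Y) where
  jump μ := by rw [← mul_assoc, h.jump, mul_assoc, h'.jump, mul_assoc]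
  jump_adj μ := by rw [← mul_assoc, h.jump_adj, mul_assoc, h'.jump_adj, mul_assoc]
  freq := by
    have : H * (X * Y) - X * Y * H = (H * X - X * H) * Y + X * (H * Y - Y * H) := by noncomm_ring
    rw [this, h.freq, h'.freq, Matrix.smul_mul, Matrix.mul_smul, ← add_smul]
    push_cast
    rfl

theorem conjTranspose (hH : H.IsHermitian) (h : IsPeripheral H L lam X) :
    IsPeripheral H L (-lam) Xᴴ where
  jump μ := by simpa using (congrArg Matrix.conjTranspose (h.jump_adj μ)).symm
  jump_adj μ := by simpa using (congrArg Matrix.conjTranspose (h.jump μ)).symm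
  freq := by
    have := congrArg Matrix.conjTranspose h.freq
    simp only [Matrix.conjTranspose_sub, Matrix.conjTranspose_mul, hH.eq,
      Matrix.conjTranspose_smul] at this
    rw [← neg_sub, this]
    simp

theorem add (h : IsPeripheral H L lam X) (h' : IsPeripheral H L lam Y) :
    IsPeripheral H L lam (X + Y) where
  jump μ := by rw [mul_add, add_mul, h.jump, h'.jump]
  jump_adj μ := by rw [mul_add, add_mul, h.jump_adj, h'.jump_adj]
  freq := by rw [mul_add, add_mul, smul_add, ← h.freq, ← h'.freq]; abel

theorem smul (h : IsPeripheral H L lam X) (c : ℂ) : IsPeripheral H L lam (c • X) where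
  jump μ := by rw [Matrix.mul_smul, Matrix.smul_mul, h.jump]
  jump_adj μ := by rw [Matrix.mul_smul, Matrix.smul_mul, h.jump_adj]
  freq := by rw [Matrix.mul_smul, Matrix.smul_mul, ← smul_sub, h.freq, smul_comm]

theorem one : IsPeripheral H L 0 (1 : Op N d) where
  jump μ := by simp
  jump_adj μ := by simp
  freq := by simp

theorem of_commute (hH : Commute H X) (hL : ∀ μ, Commute (L μ) X) (hL' : ∀ μ, Commute (L μ)ᴴ X) :
    IsPeripheral H L 0 X where
  jump μ := hL μ
  jump_adj μ := hL' μ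
  freq := by rw [hH.eq]; simp

theorem commute_hamiltonian (h : IsPeripheral H L 0 X) : Commute H X :=
  sub_eq_zero.mp (by simpa using h.freq)

end IsPeripheral

end Peripheral

/-! ### Spectrum of a unital Lindblad generator -/

section Generator

variable {N d : ℕ} {ι : Type*} [Fintype ι] {H : Op N d} {L : ι → Op N d}

theorem liouvillian_apply (H : Op N d) (L : ι → Op N d) (ρ : Op N d) :
    liouvillian H L ρ = (-Complex.I) • (H * ρ - ρ * H) +
    ∑ μ, ((2 : ℂ) • (L μ * ρ * (L μ)ᴴ) - ((L μ)ᴴ * L μ * ρ + ρ * ((L μ)ᴴ * L μ))) := rfl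

theorem heisenbergGenerator_apply (H : Op N d) (L : ι → Op N d) (X : Op N d) :
    heisenbergGenerator H L X = Complex.I • (H * X - X * H) +
    ∑ μ, ((2 : ℂ) • ((L μ)ᴴ * X * L μ) - ((L μ)ᴴ * L μ * X + X * ((L μ)ᴴ * L μ))) := rfl

theorem trace_mul_liouvillian (H : Op N d) (L : ι → Op N d) (X Y : Op N d) :
    (X * liouvillian H L Y).trace = (heisenbergGenerator H L X * Y).trace := by
  rw [liouvillian_apply, heisenbergGenerator_apply]
  simp only [mul_add, add_mul, Matrix.trace_add, Finset.mul_sum, Finset.sum_mul,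
    Matrix.trace_sum, Matrix.mul_smul, Matrix.smul_mul, Matrix.trace_smul, mul_sub, sub_mul,
    Matrix.trace_sub]
  congr 1
  · rw [← mul_assoc, Matrix.trace_mul_comm X (Y * H), mul_assoc Y, Matrix.trace_mul_comm Y,
      smul_sub, smul_sub]
    simp only [smul_eq_mul]
    ring
  · refine Finset.sum_congr rfl fun μ _ => ?_
    rw [add_comm (Matrix.trace (X * ((L μ)ᴴ * L μ * Y)))]
    congr 2
    · rw [← mul_assoc, ← mul_assoc, Matrix.trace_mul_comm, ← mul_assoc, ← mul_assoc]
    · rw [← mul_assoc X Y, Matrix.trace_mul_comm (X * Y), mul_assoc ((L μ)ᴴ * L μ)]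
    · simp only [mul_assoc]

/-- Dual form of unitality: pair with the identity. -/
theorem trace_heisenbergGenerator (hunital : liouvillian H L 1 = 0) (X : Op N d) :
    (heisenbergGenerator H L X).trace = 0 := by
  have h := trace_mul_liouvillian H L X 1
  rw [hunital, mul_zero, Matrix.trace_zero, mul_one] at h
  exact h.symm

theorem conjTranspose_heisenbergGenerator (hH : H.IsHermitian) (X : Op N d) :
    (heisenbergGenerator H L X)ᴴ = heisenbergGenerator H L Xᴴ := by
  rw [heisenbergGenerator_apply, heisenbergGenerator_apply]
  simp only [Matrix.conjTranspose_add, Matrix.conjTranspose_sum, Matrix.conjTranspose_smul,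
    Matrix.conjTranspose_sub, Matrix.conjTranspose_mul, Matrix.conjTranspose_conjTranspose, hH.eq,
    mul_assoc]
  congr 1
  · simp only [RCLike.star_def, Complex.conj_I, smul_sub, neg_smul]
    abel
  · refine Finset.sum_congr rfl fun μ _ => ?_
    rw [add_comm]
    simp

theorem conjTranspose_liouvillian (hH : H.IsHermitian) (X : Op N d) :
    (liouvillian H L X)ᴴ = liouvillian H L Xᴴ := by
  rw [liouvillian_apply, liouvillian_apply]
  simp only [Matrix.conjTranspose_add, Matrix.conjTranspose_sum, Matrix.conjTranspose_smul,
    Matrix.conjTranspose_sub, Matrix.conjTranspose_mul, Matrix.conjTranspose_conjTranspose, hH.eq,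
    mul_assoc]
  congr 1
  · simp only [star_neg, RCLike.star_def, Complex.conj_I, smul_sub, neg_smul, neg_neg]
    abel
  · refine Finset.sum_congr rfl fun μ _ => ?_
    rw [add_comm]
    simp

/-- The dissipation function of a Lindblad generator. -/
theorem heisenbergGenerator_conjTranspose_mul_self (hH : H.IsHermitian) (X : Op N d) :
    heisenbergGenerator H L (Xᴴ * X) =
      (heisenbergGenerator H L X)ᴴ * X + Xᴴ * heisenbergGenerator H L X +
        ∑ μ, (2 : ℂ) • ((L μ * X - X * L μ)ᴴ * (L μ * X - X * L μ)) := by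
  rw [conjTranspose_heisenbergGenerator hH]
  simp only [heisenbergGenerator_apply, add_mul, mul_add, Finset.sum_mul, Finset.mul_sum]
  have key : ∀ μ, ((2 : ℂ) • ((L μ)ᴴ * (Xᴴ * X) * L μ) -
      ((L μ)ᴴ * L μ * (Xᴴ * X) + (Xᴴ * X) * ((L μ)ᴴ * L μ))) =
      ((2 : ℂ) • ((L μ)ᴴ * Xᴴ * L μ) - ((L μ)ᴴ * L μ * Xᴴ + Xᴴ * ((L μ)ᴴ * L μ))) * X +
      Xᴴ * ((2 : ℂ) • ((L μ)ᴴ * X * L μ) - ((L μ)ᴴ * L μ * X + X * ((L μ)ᴴ * L μ))) +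
      (2 : ℂ) • ((L μ * X - X * L μ)ᴴ * (L μ * X - X * L μ)) := by
    intro μ
    simp only [two_smul, Matrix.conjTranspose_sub, Matrix.conjTranspose_mul]
    noncomm_ring
  rw [Finset.sum_congr rfl fun μ _ => key μ]
  simp only [Finset.sum_add_distrib]
  have hI : Complex.I • (H * (Xᴴ * X) - Xᴴ * X * H) =
      Complex.I • (H * Xᴴ - Xᴴ * H) * X + Xᴴ * (Complex.I • (H * X - X * H)) := by
    rw [Matrix.smul_mul, Matrix.mul_smul, ← smul_add]
    congr 1
    noncomm_ring
  rw [hI]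
  abel

theorem trace_conjTranspose_mul_self_eq_re (X : Op N d) :
    0 ≤ ((Xᴴ * X).trace).re ∧ (Xᴴ * X).trace = (((Xᴴ * X).trace).re : ℂ) := by
  have h := (Matrix.posSemidef_conjTranspose_mul_self X).trace_nonneg
  rw [Complex.le_def] at h
  exact ⟨h.1, Complex.ext rfl (by simpa using h.2.symm)⟩

/-- The trace of the dissipation identity: its left side vanishes by unitality, and its first two
terms on the right have the same real part. -/
theorem re_trace_conjTranspose_mul_heisenbergGenerator (hH : H.IsHermitian)
    (hunital : liouvillian H L 1 = 0) (X : Op N d) :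
    ((Xᴴ * heisenbergGenerator H L X).trace).re =
      - ∑ μ, (((L μ * X - X * L μ)ᴴ * (L μ * X - X * L μ)).trace).re := by
  have h := congrArg (fun Z => (Matrix.trace Z).re)
    (heisenbergGenerator_conjTranspose_mul_self (L := L) hH X)
  simp only [trace_heisenbergGenerator hunital, Matrix.trace_add, Matrix.trace_sum,
    Matrix.trace_smul, Complex.add_re, Complex.re_sum, Complex.zero_re] at h
  have h2 : (((heisenbergGenerator H L X)ᴴ * X).trace).re =
      ((Xᴴ * heisenbergGenerator H L X).trace).re := by
    rw [← Matrix.conjTranspose_conjTranspose X, ← Matrix.conjTranspose_mul,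
      Matrix.trace_conjTranspose, Matrix.conjTranspose_conjTranspose]
    simp
  have h3 : ∑ μ, ((2 : ℂ) • ((L μ * X - X * L μ)ᴴ * (L μ * X - X * L μ)).trace).re =
      2 * ∑ μ, (((L μ * X - X * L μ)ᴴ * (L μ * X - X * L μ)).trace).re := by
    rw [Finset.mul_sum]
    refine Finset.sum_congr rfl fun μ _ => ?_
    simp
  rw [h2, h3] at h
  linarith

theorem commute_jump_of_re_trace_eq_zero (hH : H.IsHermitian)
    (hunital : liouvillian H L 1 = 0) {X : Op N d}
    (h : ((Xᴴ * heisenbergGenerator H L X).trace).re = 0) (μ : ι) : L μ * X = X * L μ := by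
  rw [re_trace_conjTranspose_mul_heisenbergGenerator hH hunital, neg_eq_zero,
    Finset.sum_eq_zero_iff_of_nonneg fun μ _ => (trace_conjTranspose_mul_self_eq_re _).1] at h
  have h1 := (trace_conjTranspose_mul_self_eq_re (L μ * X - X * L μ)).2
  rw [h μ (Finset.mem_univ μ), Complex.ofReal_zero,
    Matrix.trace_conjTranspose_mul_self_eq_zero_iff] at h1
  exact sub_eq_zero.mp h1

theorem eigenvalue_re_nonpos (hH : H.IsHermitian) (hunital : liouvillian H L 1 = 0)
    {X : Op N d} {c : ℂ} (hX : X ≠ 0) (h : heisenbergGenerator H L X = c • X) : c.re ≤ 0 := by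
  have h1 := re_trace_conjTranspose_mul_heisenbergGenerator hH hunital X
  obtain ⟨hq, hq'⟩ := trace_conjTranspose_mul_self_eq_re X
  have hpos : 0 < ((Xᴴ * X).trace).re := by
    refine lt_of_le_of_ne hq fun h0 => hX ?_
    rw [← h0, Complex.ofReal_zero, Matrix.trace_conjTranspose_mul_self_eq_zero_iff] at hq'
    exact hq'
  rw [h, Matrix.mul_smul, Matrix.trace_smul, hq', smul_eq_mul, Complex.re_mul_ofReal] at h1
  have h2 : 0 ≤ ∑ μ, (((L μ * X - X * L μ)ᴴ * (L μ * X - X * L μ)).trace).re :=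
    Finset.sum_nonneg fun μ _ => (trace_conjTranspose_mul_self_eq_re _).1
  by_contra hc
  nlinarith [mul_pos (not_le.mp hc) hpos]

theorem sum_jump_commutator (hunital : liouvillian H L 1 = 0) :
    ∑ μ, ((2 : ℂ) • (L μ * (L μ)ᴴ) - ((L μ)ᴴ * L μ + (L μ)ᴴ * L μ)) = 0 := by
  rw [liouvillian_apply] at hunital
  simpa only [mul_one, one_mul, sub_self, smul_zero, zero_add] using hunital

namespace IsPeripheral

variable {lam : ℝ} {X : Op N d}

theorem heisenbergGenerator_eq (h : IsPeripheral H L lam X) :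
    heisenbergGenerator H L X = (Complex.I * lam) • X := by
  rw [heisenbergGenerator_apply, h.freq, smul_smul, Finset.sum_eq_zero, add_zero]
  intro μ _
  rw [h.jump_adj μ, mul_assoc ((L μ)ᴴ), h.jump μ, ← mul_assoc ((L μ)ᴴ), h.jump_adj μ, two_smul,
    mul_assoc, sub_self]

/-- Moving X to the left through all jump operators turns the dissipator into X times the dissipator
of the identity, which is zero by unitality. In the Heisenberg picture the terms cancel one by one
instead. -/
theorem liouvillian_eq (hunital : liouvillian H L 1 = 0) (h : IsPeripheral H L lam X) :
    liouvillian H L X = (-(Complex.I * lam)) • X := by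
  rw [liouvillian_apply, h.freq, smul_smul, ← neg_mul]
  convert add_zero _
  rw [← mul_zero X, ← sum_jump_commutator hunital, Finset.mul_sum]
  refine Finset.sum_congr rfl fun μ _ => ?_
  rw [h.jump μ, mul_assoc ((L μ)ᴴ), h.jump μ, ← mul_assoc ((L μ)ᴴ), h.jump_adj μ, mul_sub, mul_add,
    Matrix.mul_smul, mul_assoc, mul_assoc]

end IsPeripheral

theorem isPeripheral_of_heisenbergGenerator_eq (hH : H.IsHermitian)
    (hunital : liouvillian H L 1 = 0) {X : Op N d} {lam : ℝ}
    (h : heisenbergGenerator H L X = (Complex.I * lam) • X) : IsPeripheral H L lam X := by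
  have hre : ∀ (Y : Op N d) (r : ℝ), heisenbergGenerator H L Y = (Complex.I * r) • Y →
      ∀ μ, L μ * Y = Y * L μ := by
    intro Y r hY
    refine commute_jump_of_re_trace_eq_zero hH hunital ?_
    rw [hY, Matrix.mul_smul, Matrix.trace_smul, (trace_conjTranspose_mul_self_eq_re Y).2]
    simp
  have h1 := hre X lam h
  -- The same argument for the adjoint yields commutation with the adjoint jump operators.
  have h2 := hre Xᴴ (-lam) (by
    rw [← conjTranspose_heisenbergGenerator hH, h, Matrix.conjTranspose_smul]
    simp)
  have h3 : ∀ μ, (L μ)ᴴ * X = X * (L μ)ᴴ := fun μ => by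
    simpa using (congrArg Matrix.conjTranspose (h2 μ)).symm
  refine ⟨h1, h3, ?_⟩
  have h4 : heisenbergGenerator H L X = Complex.I • (H * X - X * H) := by
    rw [heisenbergGenerator_apply, Finset.sum_eq_zero, add_zero]
    intro μ _
    rw [h3 μ, mul_assoc ((L μ)ᴴ), h1 μ, ← mul_assoc ((L μ)ᴴ), h3 μ, two_smul,
      mul_assoc, sub_self]
  rw [h4, mul_smul] at h
  exact smul_right_injective _ Complex.I_ne_zero h

theorem isPeripheral_of_liouvillian_eq (hH : H.IsHermitian)
    (hunital : liouvillian H L 1 = 0) {X : Op N d} {lam : ℝ}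
    (h : liouvillian H L X = (-(Complex.I * lam)) • X) : IsPeripheral H L lam X := by
  have hre : ∀ (Y : Op N d) (r : ℝ), liouvillian H L Y = (-(Complex.I * r)) • Y →
      ∀ μ, L μ * Y = Y * L μ := by
    intro Y r hY
    -- By duality and conjugation, the real part of tr(Y† G Y) is that of tr(Y† ℒ Y), so the
    -- criterion for G also serves ℒ.
    refine commute_jump_of_re_trace_eq_zero hH hunital ?_
    rw [Matrix.trace_mul_comm, ← trace_mul_liouvillian, ← Matrix.conjTranspose_conjTranspose
      (Y * liouvillian H L Yᴴ), Matrix.conjTranspose_mul, conjTranspose_liouvillian hH,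
      Matrix.conjTranspose_conjTranspose, hY, Matrix.smul_mul, Matrix.trace_conjTranspose,
      Matrix.trace_smul, Matrix.trace_mul_comm, (trace_conjTranspose_mul_self_eq_re Y).2]
    simp
  have h1 := hre X lam h
  have h2 := hre Xᴴ (-lam) (by
    rw [← conjTranspose_liouvillian hH, h, Matrix.conjTranspose_smul]
    simp)
  have h3 : ∀ μ, (L μ)ᴴ * X = X * (L μ)ᴴ := fun μ => by
    simpa using (congrArg Matrix.conjTranspose (h2 μ)).symm
  refine ⟨h1, h3, ?_⟩
  have h4 : liouvillian H L X = (-Complex.I) • (H * X - X * H) := by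
    rw [liouvillian_apply]
    convert add_zero _
    rw [← mul_zero X, ← sum_jump_commutator hunital, Finset.mul_sum]
    refine Finset.sum_congr rfl fun μ _ => ?_
    rw [h1 μ, mul_assoc ((L μ)ᴴ), h1 μ, ← mul_assoc ((L μ)ᴴ), h3 μ, mul_sub, mul_add,
      Matrix.mul_smul, mul_assoc, mul_assoc]
  rw [h4, ← neg_mul, mul_smul] at h
  exact smul_right_injective _ (neg_ne_zero.mpr Complex.I_ne_zero) h

/-- The span of the eigenoperators with purely imaginary eigenvalue. -/
def peripheralSubmodule (H : Op N d) (L : ι → Op N d) : Submodule ℂ (Op N d) :=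
  Submodule.span ℂ {X | ∃ lam : ℝ, IsPeripheral H L lam X}

/-- Purely imaginary eigenvalues are semisimple. -/
theorem eigen_of_pow_eq_zero (hH : H.IsHermitian) (hunital : liouvillian H L 1 = 0) (lam : ℝ)
    (k : ℕ) (X : Op N d)
    (h : ((heisenbergGenerator H L -
      algebraMap ℂ (Module.End ℂ (Op N d)) (Complex.I * lam)) ^ k) X = 0) :
    heisenbergGenerator H L X = (Complex.I * lam) • X := by
  set K := heisenbergGenerator H L - algebraMap ℂ (Module.End ℂ (Op N d)) (Complex.I * lam) with hK
  have hKa : ∀ Y, K Y = heisenbergGenerator H L Y - (Complex.I * lam) • Y := fun Y => by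
    simp [hK, Algebra.algebraMap_eq_smul_one]
  induction k generalizing X with
  | zero =>
    have : X = 0 := by simpa using h
    simp [this]
  | succ k ih =>
    rw [pow_succ, Module.End.mul_apply] at h
    have h1 := (isPeripheral_of_heisenbergGenerator_eq hH hunital (ih _ h)).conjTranspose hH
    have h2 := h1.liouvillian_eq hunital
    -- By induction K X is a genuine eigenoperator, so its adjoint is an eigenoperator of ℒ and
    -- annihilates the range of K under the trace pairing. As K X lies in that range, its norm is
    -- zero.
    have h3 : ((K X)ᴴ * K X).trace = 0 := by
      nth_rw 2 [hKa]
      rw [mul_sub, Matrix.trace_sub, Matrix.trace_mul_comm, ← trace_mul_liouvillian, h2,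
        Matrix.mul_smul, Matrix.mul_smul, Matrix.trace_smul, Matrix.trace_smul,
        Matrix.trace_mul_comm X]
      simp
    rw [Matrix.trace_conjTranspose_mul_self_eq_zero_iff, hKa, sub_eq_zero] at h3
    exact h3

theorem decaySubmodule_sup_peripheralSubmodule (hH : H.IsHermitian)
    (hunital : liouvillian H L 1 = 0) :
    decaySubmodule (heisenbergGenerator H L) ⊔ peripheralSubmodule H L = ⊤ := by
  rw [eq_top_iff, ← Module.End.iSup_maxGenEigenspace_eq_top (heisenbergGenerator H L)]
  refine iSup_le fun c X hX => ?_
  obtain ⟨k, hk⟩ := (Module.End.mem_maxGenEigenspace _ _ _).mp hX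
  rw [← Algebra.algebraMap_eq_smul_one] at hk
  by_cases hX0 : X = 0
  · rw [hX0]; exact zero_mem _
  have hc : c.re ≤ 0 := by
    by_contra hc
    -- For Re c > 0 there is no eigenvector, so G - c and all its powers are injective.
    refine hX0 (((injective_iff_map_eq_zero _).mpr ?_ :
      Function.Injective ((heisenbergGenerator H L -
        algebraMap ℂ (Module.End ℂ (Op N d)) c) ^ k)) (hk.trans (map_zero _).symm))
    rw [← injective_iff_map_eq_zero, Module.End.coe_pow]
    refine Function.Injective.iterate ((injective_iff_map_eq_zero _).mpr fun Y hY => ?_) k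
    by_contra hY0
    refine hc (eigenvalue_re_nonpos hH hunital hY0 ?_)
    rw [LinearMap.sub_apply, sub_eq_zero] at hY
    simpa [Algebra.algebraMap_eq_smul_one] using hY
  rcases hc.lt_or_eq with hc | hc
  · exact Submodule.mem_sup_left (mem_decaySubmodule_of_pow_eq_zero _ hc k X hk)
  · have hc' : c = Complex.I * (c.im : ℂ) := Complex.ext (by simp [hc]) (by simp)
    rw [hc'] at hk
    exact Submodule.mem_sup_right (Submodule.subset_span ⟨c.im,
      isPeripheral_of_heisenbergGenerator_eq hH hunital
        (eigen_of_pow_eq_zero hH hunital c.im k X hk)⟩)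

theorem trace_evolve_mul_of_isPeripheral (hunital : liouvillian H L 1 = 0) {Y : Op N d} {lam : ℝ}
    (hY : IsPeripheral H L lam Y) (X : Op N d) (t : ℝ) :
    (evolve (heisenbergGenerator H L) t X * Y).trace =
      Complex.exp (t * -(Complex.I * lam)) * (X * Y).trace := by
  rw [← trace_mul_evolve _ _ (trace_mul_liouvillian H L),
    evolve_of_eigen _ _ _ _ (hY.liouvillian_eq hunital), Matrix.mul_smul, Matrix.trace_smul,
    smul_eq_mul]

theorem norm_exp_mul_I (t lam : ℝ) : ‖Complex.exp (t * -(Complex.I * lam))‖ = 1 := by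
  simp [Complex.norm_exp]

/-- The pairing with Y only acquires a phase under the evolution of X, so its modulus is constant;
it also tends to zero. -/
theorem trace_mul_eq_zero_of_mem_decaySubmodule (hunital : liouvillian H L 1 = 0)
    {X Y : Op N d} {lam : ℝ} (hX : X ∈ decaySubmodule (heisenbergGenerator H L))
    (hY : IsPeripheral H L lam Y) : (X * Y).trace = 0 := by
  have h := (decays_trace_mul hX Y).tendsto.norm
  have h2 : ∀ t, ‖(Y * evolve (heisenbergGenerator H L) t X).trace‖ = ‖(X * Y).trace‖ := by
    intro t
    rw [Matrix.trace_mul_comm, trace_evolve_mul_of_isPeripheral hunital hY, norm_mul,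
      norm_exp_mul_I, one_mul]
  simp only [h2, norm_zero] at h
  exact norm_eq_zero.mp (tendsto_nhds_unique tendsto_const_nhds h)

/-- Peripheral operators are closed under adjoints, so the peripheral part V of D is orthogonal to
the whole peripheral space, in particular to itself. -/
theorem mem_decaySubmodule_of_trace_eq_zero (hH : H.IsHermitian)
    (hunital : liouvillian H L 1 = 0) {D : Op N d}
    (hD : ∀ (lam : ℝ) (Y : Op N d), IsPeripheral H L lam Y → (D * Y).trace = 0) :
    D ∈ decaySubmodule (heisenbergGenerator H L) := by
  have hmem : D ∈ decaySubmodule (heisenbergGenerator H L) ⊔ peripheralSubmodule H L := by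
    rw [decaySubmodule_sup_peripheralSubmodule hH hunital]; trivial
  obtain ⟨S, hS, V, hV, rfl⟩ := Submodule.mem_sup.mp hmem
  have h1 : ∀ (lam : ℝ) (Y : Op N d), IsPeripheral H L lam Y → (Yᴴ * V).trace = 0 := by
    intro lam Y hY
    have h2 := hD _ _ (hY.conjTranspose hH)
    rwa [add_mul, Matrix.trace_add, trace_mul_eq_zero_of_mem_decaySubmodule hunital hS
      (hY.conjTranspose hH), zero_add, Matrix.trace_mul_comm] at h2
  have h3 : ∀ Y ∈ peripheralSubmodule H L, (Yᴴ * V).trace = 0 := by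
    intro Y hY
    induction hY using Submodule.span_induction with
    | mem Y hY => obtain ⟨lam, hY⟩ := hY; exact h1 lam Y hY
    | zero => simp
    | add Y Z _ _ hY hZ => rw [Matrix.conjTranspose_add, add_mul, Matrix.trace_add, hY, hZ, add_zero]
    | smul c Y _ hY => rw [Matrix.conjTranspose_smul, Matrix.smul_mul, Matrix.trace_smul, hY,
        smul_zero]
  have hV0 : V = 0 := Matrix.trace_conjTranspose_mul_self_eq_zero_iff.mp (h3 V hV)
  rwa [hV0, add_zero]

end Generator

/-! ### Polar decomposition, square roots, Cayley transform -/

section MatrixFacts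

variable {n : Type*} [Fintype n] [DecidableEq n]

/-- The polar decomposition, with the partial isometry completed to a unitary. -/
theorem exists_unitary_mul_eq {X B : Matrix n n ℂ} (h : Xᴴ * X = Bᴴ * B) :
    ∃ A ∈ Matrix.unitaryGroup n ℂ, A * B = X := by
  let T := Matrix.toEuclideanCLM (n := n) (𝕜 := ℂ)
  have hnorm : ∀ x, ‖T X x‖ = ‖T B x‖ := by
    have hs : ∀ (Z : Matrix n n ℂ) x, ‖T Z x‖ ^ 2 = (inner ℂ x (T (Zᴴ * Z) x)).re := by
      intro Z x
      rw [← Matrix.star_eq_conjTranspose, map_mul, map_star, ContinuousLinearMap.star_eq_adjoint]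
      exact ContinuousLinearMap.apply_norm_sq_eq_inner_adjoint_right (T Z) x
    intro x
    have := hs X x
    rw [h, ← hs B x] at this
    exact (sq_eq_sq₀ (norm_nonneg _) (norm_nonneg _)).mp this
  have hker : LinearMap.ker (T B).toLinearMap ≤ LinearMap.ker (T X).toLinearMap := by
    intro x hx
    rw [LinearMap.mem_ker] at hx ⊢
    have hx' : T B x = 0 := hx
    have := hnorm x
    rw [hx', norm_zero, norm_eq_zero] at this
    exact this
  let e := (T B).toLinearMap.quotKerEquivRange
  -- The map Bx ↦ Xx is well defined and isometric on the range of B; in finite dimension it extends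
  -- to an isometry of the whole space.
  let K : LinearMap.range (T B).toLinearMap →ₗ[ℂ] EuclideanSpace ℂ n :=
    ((LinearMap.ker (T B).toLinearMap).liftQ (T X).toLinearMap hker).comp e.symm.toLinearMap
  have hK : ∀ x, K ⟨T B x, LinearMap.mem_range_self _ x⟩ = T X x := by
    intro x
    have : e.symm ⟨T B x, LinearMap.mem_range_self _ x⟩ = Submodule.Quotient.mk x := by
      rw [LinearEquiv.symm_apply_eq]
      rfl
    simp only [K, LinearMap.comp_apply, LinearEquiv.coe_coe, this]
    rfl
  let J : LinearMap.range (T B).toLinearMap →ₗᵢ[ℂ] EuclideanSpace ℂ n :=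
    { toLinearMap := K
      norm_map' := by
        rintro ⟨_, x, rfl⟩
        exact (congrArg _ (hK x)).trans (hnorm x) }
  let U := J.extend.toContinuousLinearMap
  refine ⟨T.symm U, ?_, ?_⟩
  · rw [Matrix.mem_unitaryGroup_iff']
    refine EquivLike.injective T ?_
    rw [map_mul, map_star, StarAlgEquiv.apply_symm_apply, map_one,
      ContinuousLinearMap.star_eq_adjoint]
    exact (ContinuousLinearMap.norm_map_iff_adjoint_comp_self U).mp fun x => J.extend.norm_map x
  · refine EquivLike.injective T ?_
    rw [map_mul, StarAlgEquiv.apply_symm_apply]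
    ext1 x
    change J.extend (T B x) = T X x
    rw [← hK x]
    exact J.extend_apply ⟨T B x, LinearMap.mem_range_self _ x⟩

-- Functional calculus gives a root that commutes with everything commuting with Q, so the modulus
-- of a peripheral operator stays peripheral.
open scoped MatrixOrder in
theorem exists_posSemidef_sqrt {Q : Matrix n n ℂ} (hQ : Q.PosSemidef) :
    ∃ B : Matrix n n ℂ, B.PosSemidef ∧ B * B = Q ∧ ∀ Z, Commute Q Z → Commute B Z := by
  refine ⟨CFC.sqrt Q, Matrix.nonneg_iff_posSemidef.mp (CFC.sqrt_nonneg Q), CFC.sqrt_mul_sqrt_self Q hQ.nonneg,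
    fun Z hZ => ?_⟩
  exact hZ.cfcₙ_nnreal _

/-- The Cayley transform of a Hermitian matrix. -/
theorem exists_unitary_cayley {X : Matrix n n ℂ} (hX : X.IsHermitian) :
    ∃ W : Matrix n n ℂ, (1 - (2 * Complex.I) • W) ∈ Matrix.unitaryGroup n ℂ ∧
      ∀ Z, Commute Z X ↔ Commute Z W := by
  -- The right side is positive definite, so X + i is invertible. With W its inverse, 1 - 2iW is (X
  -- - i)(X + i)⁻¹.
  have hfac : (X - Complex.I • 1) * (X + Complex.I • 1) = Xᴴ * X + 1 := by
    rw [hX.eq]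
    simp only [sub_mul, mul_add, Matrix.mul_smul, Matrix.smul_mul, mul_one, one_mul, smul_smul,
      Complex.I_mul_I, neg_smul, one_smul]
    abel
  have hdet : IsUnit (X + Complex.I • (1 : Matrix n n ℂ)).det := by
    have hpos : (Xᴴ * X + 1).PosDef :=
      Matrix.PosDef.posSemidef_add (Matrix.posSemidef_conjTranspose_mul_self X) Matrix.PosDef.one
    have h := (Matrix.isUnit_iff_isUnit_det _).mp hpos.isUnit
    rw [← hfac, Matrix.det_mul] at h
    exact isUnit_of_mul_isUnit_right h
  set R := X + Complex.I • (1 : Matrix n n ℂ) with hR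
  have h1 : R * R⁻¹ = 1 := Matrix.mul_nonsing_inv R hdet
  have h2 : R⁻¹ * R = 1 := Matrix.nonsing_inv_mul R hdet
  have hcomm : ∀ Z, Commute Z X ↔ Commute Z R := fun Z => by
    have hz : Commute Z (Complex.I • (1 : Matrix n n ℂ)) := (Commute.one_right Z).smul_right _
    exact ⟨fun h => h.add_right hz, fun h => by simpa [hR] using h.sub_right hz⟩
  refine ⟨R⁻¹, ?_, fun Z => ?_⟩
  · rw [Matrix.mem_unitaryGroup_iff', Matrix.star_eq_conjTranspose]
    have h3 : R⁻¹ᴴ * Rᴴ = 1 := by rw [← Matrix.conjTranspose_mul, h1, Matrix.conjTranspose_one]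
    have hRR : R - Rᴴ = (2 * Complex.I) • 1 := by
      rw [hR, Matrix.conjTranspose_add, hX.eq, Matrix.conjTranspose_smul]
      simp [two_mul, add_smul]
    have h4 : R⁻¹ᴴ - R⁻¹ = (2 * Complex.I) • (R⁻¹ᴴ * R⁻¹) := by
      have : R⁻¹ᴴ * (R - Rᴴ) * R⁻¹ = R⁻¹ᴴ - R⁻¹ := by
        rw [mul_sub, h3, sub_mul, mul_assoc, h1, mul_one, one_mul]
      rw [← this, hRR, Matrix.mul_smul, Matrix.smul_mul, mul_one]
    have h5 : (1 - (2 * Complex.I) • R⁻¹)ᴴ = 1 + (2 * Complex.I) • R⁻¹ᴴ := by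
      rw [Matrix.conjTranspose_sub, Matrix.conjTranspose_smul]
      simp
    rw [h5]
    have h6 : (1 + (2 * Complex.I) • R⁻¹ᴴ) * (1 - (2 * Complex.I) • R⁻¹) =
        1 + (2 * Complex.I) • ((R⁻¹ᴴ - R⁻¹) - (2 * Complex.I) • (R⁻¹ᴴ * R⁻¹)) := by
      simp only [add_mul, mul_sub, Matrix.mul_smul, Matrix.smul_mul, mul_one, one_mul, smul_sub]
      abel
    rw [h6, h4, sub_self, smul_zero, add_zero]
  · rw [hcomm]
    constructor
    · intro h
      calc Z * R⁻¹ = R⁻¹ * (R * Z) * R⁻¹ := by rw [← mul_assoc, h2, one_mul]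
        _ = R⁻¹ * Z := by rw [← h.eq, mul_assoc, mul_assoc, h1, mul_one]
    · intro h
      calc Z * R = R * (R⁻¹ * Z) * R := by rw [← mul_assoc, h1, one_mul]
        _ = R * Z := by rw [← h.eq, mul_assoc, mul_assoc, h2, mul_one]

open scoped MatrixOrder Matrix.Norms.L2Operator in
theorem span_posSemidef : Submodule.span ℂ {Z : Matrix n n ℂ | Z.PosSemidef} = ⊤ := by
  have h := CStarAlgebra.span_nonneg (A := Matrix n n ℂ)
  simpa only [Matrix.nonneg_iff_posSemidef] using h

end MatrixFacts

/-! ### Peripheral operators and modes -/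

section Modes

variable {N d : ℕ} {ι : Type*} [Fintype ι] {H : Op N d} {L : ι → Op N d}

/-- Both B and AB commute with the jump operators and their adjoints, so the commutators with A
vanish on B. The sign of the frequency flips because a mode refers to the Schrödinger picture. -/
theorem isMode_of_isPeripheral (hunital : liouvillian H L 1 = 0) {A B : Op N d} {lam : ℝ}
    (hA : A ∈ Matrix.unitaryGroup (Fin N → Fin d) ℂ) (hB : B.PosSemidef) (hB0 : B ≠ 0)
    (hB' : IsPeripheral H L 0 B) (hAB : IsPeripheral H L lam (A * B)) :
    IsMode H L A (B.trace⁻¹ • B) (-lam) where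
  unitary := hA
  ness := by
    have htr : B.trace ≠ 0 := fun h => hB0 (hB.trace_eq_zero_iff.mp h)
    refine ⟨⟨hB.smul (inv_nonneg.mpr hB.trace_nonneg), ?_⟩, ?_⟩
    · rw [Matrix.trace_smul, smul_eq_mul, inv_mul_cancel₀ htr]
    · rw [map_smul, hB'.liouvillian_eq hunital]
      simp
  jump μ := by
    rw [Matrix.mul_smul, sub_mul, mul_assoc, hAB.jump, mul_assoc A (L μ), hB'.jump, mul_assoc,
      sub_self, smul_zero]
  freq := by
    have h1 : ∀ μ, ((L μ)ᴴ * A - A * (L μ)ᴴ) * L μ * B = 0 := by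
      intro μ
      rw [mul_assoc, hB'.jump, ← mul_assoc, sub_mul, mul_assoc _ A B, hAB.jump_adj,
        mul_assoc A _ B, hB'.jump_adj, ← mul_assoc, sub_self, zero_mul]
    have h2 : (H * A - A * H) * B = (lam : ℂ) • (A * B) := by
      rw [← hAB.freq, sub_mul, mul_assoc, mul_assoc A H, hB'.commute_hamiltonian.eq, mul_assoc A B]
    rw [Matrix.mul_smul, sub_mul, Finset.sum_mul, Finset.sum_eq_zero fun μ _ => h1 μ, sub_zero,
      Matrix.smul_mul, h2, Matrix.mul_smul, smul_smul, smul_smul, smul_smul]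
    congr 1
    push_cast
    ring

theorem AllModesCommute.mul_eq {P : Op N d} (hP : AllModesCommute H L P)
    (hunital : liouvillian H L 1 = 0) {A B : Op N d} {lam : ℝ}
    (hA : A ∈ Matrix.unitaryGroup (Fin N → Fin d) ℂ) (hB : B.PosSemidef)
    (hB' : IsPeripheral H L 0 B) (hAB : IsPeripheral H L lam (A * B)) :
    P * A * B = A * P * B := by
  by_cases hB0 : B = 0
  · simp [hB0]
  have htr : B.trace ≠ 0 := fun h => hB0 (hB.trace_eq_zero_iff.mp h)
  have h := hP _ _ _ (isMode_of_isPeripheral hunital hA hB hB0 hB' hAB)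
  rw [Matrix.mul_smul, smul_eq_zero_iff_right (inv_ne_zero htr), sub_mul, sub_eq_zero] at h
  exact h

/-- The Cayley transform of X is a conserved unitary, hence a mode over the maximally mixed state.
There the condition on the commutator holds without restriction to a range, and X has the same
commutant as its transform. -/
theorem AllModesCommute.commute_of_isHermitian {P : Op N d} (hP : AllModesCommute H L P)
    (hunital : liouvillian H L 1 = 0) {X : Op N d} (hX : X.IsHermitian)
    (hX' : IsPeripheral H L 0 X) : Commute P X := by
  obtain ⟨W, hU, hW⟩ := exists_unitary_cayley hX
  have hWper : IsPeripheral H L 0 W := .of_commute ((hW _).mp hX'.commute_hamiltonian)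
    (fun μ => (hW _).mp (hX'.jump μ)) (fun μ => (hW _).mp (hX'.jump_adj μ))
  have hUper : IsPeripheral H L 0 ((1 - (2 * Complex.I) • W) * 1) := by
    rw [mul_one, sub_eq_add_neg, ← neg_smul]
    exact IsPeripheral.one.add (hWper.smul _)
  have h := hP.mul_eq hunital hU Matrix.PosSemidef.one IsPeripheral.one hUper
  rw [mul_one, mul_one, mul_sub, sub_mul, mul_one, one_mul, sub_right_inj, Matrix.mul_smul,
    Matrix.smul_mul] at h
  exact (hW _).mpr (smul_right_injective _ (by simp) h)

/-- With X = AB polar, the mode condition gives PAB = APB, and the Hermitian case for B moves P past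
B. -/
theorem AllModesCommute.commute {P : Op N d} (hP : AllModesCommute H L P) (hH : H.IsHermitian)
    (hunital : liouvillian H L 1 = 0) {X : Op N d} {lam : ℝ} (hX : IsPeripheral H L lam X) :
    Commute P X := by
  obtain ⟨B, hB, hBB, hcomm⟩ := exists_posSemidef_sqrt (Matrix.posSemidef_conjTranspose_mul_self X)
  have hQ : IsPeripheral H L 0 (Xᴴ * X) := by
    simpa using (hX.conjTranspose hH).mul hX
  have hBper : IsPeripheral H L 0 B := .of_commute (hcomm _ hQ.commute_hamiltonian.symm).symm
    (fun μ => (hcomm _ (hQ.jump μ).symm).symm) (fun μ => (hcomm _ (hQ.jump_adj μ).symm).symm)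
  obtain ⟨A, hA, hAB⟩ := exists_unitary_mul_eq (X := X) (B := B) (by rw [hB.1.eq, hBB])
  have h := hP.mul_eq hunital hA hB hBper (hAB ▸ hX)
  have hPB := hP.commute_of_isHermitian hunital hB.1 hBper
  change P * X = X * P
  rw [← hAB, ← mul_assoc, h, mul_assoc, hPB.eq, mul_assoc]

/-- `A ρ` is an eigenoperator of the Liouvillian for every mode `(A, ρ, lam)`. -/
theorem IsMode.liouvillian_eq {A ρ : Op N d} {lam : ℝ} (h : IsMode H L A ρ lam) :
    liouvillian H L (A * ρ) = (Complex.I * lam) • (A * ρ) := by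
  have hj : ∀ μ, L μ * (A * ρ) = A * (L μ * ρ) := fun μ => by
    have := h.jump μ
    rwa [sub_mul, sub_eq_zero, mul_assoc, mul_assoc] at this
  -- Subtracting A ℒ(ρ) = 0 leaves only commutators with A.
  rw [← h.freq, ← sub_zero (liouvillian H L (A * ρ)), ← mul_zero A, ← h.ness.2,
    liouvillian_apply, liouvillian_apply, mul_add, Finset.mul_sum, add_sub_add_comm,
    ← Finset.sum_sub_distrib, sub_mul, Finset.sum_mul, sub_eq_add_neg _ (∑ μ, _),
    ← Finset.sum_neg_distrib]
  congr 1
  · rw [Matrix.mul_smul, ← smul_sub, Matrix.smul_mul]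
    congr 1
    noncomm_ring
  · refine Finset.sum_congr rfl fun μ _ => ?_
    have h1 : L μ * (A * ρ) * (L μ)ᴴ = A * (L μ * ρ * (L μ)ᴴ) := by
      rw [hj, mul_assoc]
    have h2 : (L μ)ᴴ * L μ * (A * ρ) = (L μ)ᴴ * A * L μ * ρ := by
      rw [mul_assoc, hj]
      simp only [mul_assoc]
    rw [h1, h2, mul_sub, Matrix.mul_smul]
    noncomm_ring

end Modes

/-! ### Permutations of the subsystems -/

section Permutations

variable {N d : ℕ}

theorem mul_permOp_apply (M : Op N d) (π : Equiv.Perm (Fin N)) (s s' : Fin N → Fin d) :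
    (M * permOp d π) s s' = M s (s' ∘ π) := by
  simp [Matrix.mul_apply, permOp]

theorem permOp_mul_apply (M : Op N d) (π : Equiv.Perm (Fin N)) (s s' : Fin N → Fin d) :
    (permOp d π * M) s s' = M (s ∘ π.symm) s' := by
  have h : ∀ u : Fin N → Fin d, s = u ∘ π ↔ u = s ∘ π.symm := fun u => by
    rw [eq_comm (a := u), Equiv.comp_symm_eq]
  simp [Matrix.mul_apply, permOp, h]

theorem permOp_mul_permOp (π σ : Equiv.Perm (Fin N)) :
    permOp d π * permOp d σ = permOp d (σ * π) := by
  ext s s'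
  rw [mul_permOp_apply]
  simp only [permOp, Matrix.of_apply, Equiv.Perm.coe_mul]
  rfl

theorem permOp_one : permOp d (1 : Equiv.Perm (Fin N)) = 1 := by
  ext s s'
  simp [permOp, Matrix.one_apply]

theorem permOp_mul_self {π : Equiv.Perm (Fin N)} (hπ : Function.Involutive π) :
    permOp d π * permOp d π = 1 := by
  rw [permOp_mul_permOp, ← permOp_one]
  congr 1
  ext i
  simp [hπ i]

theorem permOp_conj_localOp {π : Equiv.Perm (Fin N)} (hπ : Function.Involutive π)
    (O : Matrix (Fin d) (Fin d) ℂ) {j k : Fin N} (h : π j = k) :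
    permOp d π * localOp O k * permOp d π = localOp O j := by
  have hsymm : π.symm = π := Equiv.ext fun i => by rw [Equiv.symm_apply_eq, hπ i]
  have hk : π k = j := by rw [← h, hπ j]
  ext s s'
  rw [mul_permOp_apply, permOp_mul_apply, hsymm]
  have hiff : (∀ i, i ≠ k → s (π i) = s' (π i)) ↔ ∀ i, i ≠ j → s i = s' i := by
    constructor
    · intro hi i hij
      simpa [hπ i] using hi (π i) fun hc => hij (by rw [← hπ i, hc, hk])
    · exact fun hi i hik => hi (π i) fun hc => hik (by rw [← hπ i, hc, h])
  simp [localOp, hiff, hk]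

theorem trace_localOp_mul_eq {π : Equiv.Perm (Fin N)} (hπ : Function.Involutive π)
    (O : Matrix (Fin d) (Fin d) ℂ) {j k : Fin N} (h : π j = k) {Y : Op N d}
    (hY : Commute (permOp d π) Y) : (localOp O j * Y).trace = (localOp O k * Y).trace := by
  rw [← permOp_conj_localOp hπ O h, mul_assoc, hY.eq, ← mul_assoc, Matrix.trace_mul_comm,
    mul_assoc, ← mul_assoc (permOp d π), permOp_mul_self hπ, one_mul]

/-- Adjacent transpositions generate the symmetric group. -/
theorem commute_permOp_of_neighbours {Y : Op N d}
    (h : ∀ i i' : Fin N, (i' : ℕ) = (i : ℕ) + 1 → Commute (swapOp d i i') Y)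
    (π : Equiv.Perm (Fin N)) : Commute (permOp d π) Y := by
  cases N with
  | zero =>
    rw [Subsingleton.elim π 1, permOp_one]
    exact Commute.one_left Y
  | succ N =>
    have hπ : π ∈ Submonoid.closure
        (Set.range fun i : Fin N => Equiv.swap i.castSucc i.succ) := by
      rw [Equiv.Perm.mclosure_swap_castSucc_succ]
      trivial
    induction hπ using Submonoid.closure_induction with
    | mem π hπ => obtain ⟨i, rfl⟩ := hπ; exact h _ _ (by simp)
    | one => rw [permOp_one]; exact Commute.one_left Y
    | mul π σ _ _ hπ hσ => rw [← permOp_mul_permOp]; exact hσ.mul_left hπ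

end Permutations

/-! ### From commuting modes to synchronization -/

section Synchronization

variable {N d : ℕ} {ι : Type*} [Fintype ι] {H : Op N d} {L : ι → Op N d}

theorem expectation_eq (H : Op N d) (L : ι → Op N d) (ρ X : Op N d) (t : ℝ) :
    expectation H L ρ X t = (heisenberg H L X t * ρ).trace :=
  trace_mul_evolve _ _ (trace_mul_liouvillian H L) t X ρ

theorem evolve_mem_peripheralSubmodule {V : Op N d} (hV : V ∈ peripheralSubmodule H L) (t : ℝ) :
    evolve (heisenbergGenerator H L) t V ∈ peripheralSubmodule H L := by
  induction hV using Submodule.span_induction with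
  | mem Y hY =>
    obtain ⟨lam, hY⟩ := hY
    rw [evolve_of_eigen _ _ _ _ hY.heisenbergGenerator_eq]
    exact Submodule.smul_mem _ _ (Submodule.subset_span ⟨lam, hY⟩)
  | zero => rw [evolve_zero]; exact zero_mem _
  | add Y Z _ _ hY hZ => rw [evolve_add]; exact add_mem hY hZ
  | smul c Y _ hY => rw [evolve_smul]; exact Submodule.smul_mem _ _ hY

omit [Fintype ι] in
theorem commute_of_mem_peripheralSubmodule {P : Op N d}
    (hP : ∀ (lam : ℝ) (Y : Op N d), IsPeripheral H L lam Y → Commute P Y)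
    {V : Op N d} (hV : V ∈ peripheralSubmodule H L) : Commute P V := by
  induction hV using Submodule.span_induction with
  | mem Y hY => obtain ⟨lam, hY⟩ := hY; exact hP lam Y hY
  | zero => exact Commute.zero_right P
  | add Y Z _ _ hY hZ => exact hY.add_right hZ
  | smul c Y _ hY => exact hY.smul_right c

/-- The peripheral part stays peripheral, hence invariant under conjugation by P; only the decaying
part contributes. -/
theorem decays_sub_conj (hH : H.IsHermitian) (hunital : liouvillian H L 1 = 0) {P : Op N d}
    (hPP : P * P = 1) (hP : ∀ (lam : ℝ) (Y : Op N d), IsPeripheral H L lam Y → Commute P Y)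
    (X : Op N d) (s s' : Fin N → Fin d) :
    DecaysExponentially fun t => heisenberg H L X t s s' - (P * heisenberg H L X t * P) s s' := by
  have hmem : X ∈ decaySubmodule (heisenbergGenerator H L) ⊔ peripheralSubmodule H L := by
    rw [decaySubmodule_sup_peripheralSubmodule hH hunital]; trivial
  obtain ⟨S, hS, V, hV, rfl⟩ := Submodule.mem_sup.mp hmem
  have h : ∀ t, heisenberg H L (S + V) t s s' - (P * heisenberg H L (S + V) t * P) s s' =
      evolve (heisenbergGenerator H L) t S s s' -
        (P * evolve (heisenbergGenerator H L) t S * P) s s' := by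
    intro t
    have hc := commute_of_mem_peripheralSubmodule hP (evolve_mem_peripheralSubmodule hV t)
    rw [heisenberg, evolve_add, mul_add, add_mul, hc.eq, mul_assoc _ P P, hPP, mul_one,
      Matrix.add_apply, Matrix.add_apply]
    ring
  simp only [h]
  exact (hS s s').sub (decays_mul_mul hS P P s s')

theorem not_tendsto_trace_of_isPeripheral (hunital : liouvillian H L 1 = 0) {X Y : Op N d}
    {lam : ℝ} (hlam : lam ≠ 0) (hY : IsPeripheral H L lam Y) (hXY : (X * Y).trace ≠ 0) (c : ℂ) :
    ¬ Tendsto (fun t => (heisenberg H L X t * Y).trace) atTop (𝓝 c) := by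
  intro h
  have hf : ∀ t, (heisenberg H L X t * Y).trace =
      Complex.exp (t * -(Complex.I * lam)) * (X * Y).trace :=
    trace_evolve_mul_of_isPeripheral hunital hY X
  simp only [hf] at h
  -- A shift by half a period changes the sign, so the limit would be 0, against the constant
  -- modulus.
  have hshift := h.comp (tendsto_atTop_add_const_right atTop (Real.pi / lam) tendsto_id)
  have hneg : ∀ t : ℝ, Complex.exp (((t + Real.pi / lam : ℝ) : ℂ) * -(Complex.I * lam)) =
      -Complex.exp (t * -(Complex.I * lam)) := by
    intro t
    have hl : (lam : ℂ) ≠ 0 := Complex.ofReal_ne_zero.mpr hlam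
    have : ((t + Real.pi / lam : ℝ) : ℂ) * -(Complex.I * lam) =
        t * -(Complex.I * lam) - Real.pi * Complex.I := by
      push_cast
      field_simp
      ring
    rw [this, Complex.exp_sub, Complex.exp_pi_mul_I, div_neg, div_one]
  have h2 : Tendsto (fun t : ℝ => -(Complex.exp (t * -(Complex.I * lam)) * (X * Y).trace))
      atTop (𝓝 c) := by
    refine hshift.congr fun t => ?_
    simp only [Function.comp, id, hneg, neg_mul]
  have hc : c = 0 := self_eq_neg.mp (tendsto_nhds_unique h2 h.neg)
  have h3 := h.norm
  simp only [norm_mul, norm_exp_mul_I, one_mul, hc, norm_zero] at h3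
  exact hXY (norm_eq_zero.mp (tendsto_nhds_unique tendsto_const_nhds h3))

/-- States span all operators. This turns the oscillation seen by Y, which need not be a state, into
one seen by some initial state. -/
theorem tendsto_of_tendsto_states {F : ℝ → Op N d}
    (h : ∀ ρ : Op N d, IsState ρ → ∃ c : ℂ, Tendsto (fun t => (F t * ρ).trace) atTop (𝓝 c))
    (Y : Op N d) : ∃ c : ℂ, Tendsto (fun t => (F t * Y).trace) atTop (𝓝 c) := by
  have hY : Y ∈ Submodule.span ℂ {Z : Op N d | Z.PosSemidef} := by
    rw [span_posSemidef]; trivial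
  induction hY using Submodule.span_induction with
  | mem Z hZ =>
    have hZ : Z.PosSemidef := hZ
    by_cases hZ0 : Z = 0
    · exact ⟨0, by simp [hZ0]⟩
    have htr : Z.trace ≠ 0 := fun h => hZ0 (hZ.trace_eq_zero_iff.mp h)
    obtain ⟨c, hc⟩ := h (Z.trace⁻¹ • Z) ⟨hZ.smul (inv_nonneg.mpr hZ.trace_nonneg), by
      rw [Matrix.trace_smul, smul_eq_mul, inv_mul_cancel₀ htr]⟩
    refine ⟨Z.trace * c, (hc.const_mul Z.trace).congr fun t => ?_⟩
    rw [Matrix.mul_smul, Matrix.trace_smul, smul_eq_mul, mul_inv_cancel_left₀ htr]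
  | zero => exact ⟨0, by simp⟩
  | add Y Z _ _ hY hZ =>
    obtain ⟨a, ha⟩ := hY
    obtain ⟨b, hb⟩ := hZ
    exact ⟨a + b, by simpa [mul_add] using ha.add hb⟩
  | smul c Y _ hY =>
    obtain ⟨a, ha⟩ := hY
    exact ⟨c * a, by simpa using ha.const_mul c⟩

theorem robustlyStablySynchronized_of_commute (hH : H.IsHermitian)
    (hunital : liouvillian H L 1 = 0) (O : Matrix (Fin d) (Fin d) ℂ) {j k : Fin N}
    {π : Equiv.Perm (Fin N)} (hπ : Function.Involutive π) (hjk : π j = k)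
    (hP : ∀ (lam : ℝ) (Y : Op N d), IsPeripheral H L lam Y → Commute (permOp d π) Y)
    (hosc : ∃ (lam : ℝ) (Y : Op N d), lam ≠ 0 ∧ IsPeripheral H L lam Y ∧
      (localOp O j * Y).trace ≠ 0) :
    RobustlyStablySynchronized H L O (permOp d π) j k := by
  obtain ⟨lam, Y, hlam, hY, hOY⟩ := hosc
  have hnot := not_tendsto_trace_of_isPeripheral hunital hlam hY hOY
  have hdiff : localOp O j - localOp O k ∈ decaySubmodule (heisenbergGenerator H L) := by
    refine mem_decaySubmodule_of_trace_eq_zero hH hunital fun lam' Z hZ => ?_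
    rw [sub_mul, Matrix.trace_sub, trace_localOp_mul_eq hπ O hjk (hP lam' Z hZ), sub_self]
  have hsame : ∀ ρ : Op N d,
      EventuallySame (expectation H L ρ (localOp O j)) (expectation H L ρ (localOp O k)) := by
    intro ρ
    change DecaysExponentially _
    have h := decays_trace_mul hdiff ρ
    refine cast (congrArg DecaysExponentially (funext fun t => ?_)) h
    rw [expectation_eq, expectation_eq, heisenberg, heisenberg, ← Matrix.trace_sub, ← sub_mul,
      ← evolve_sub, Matrix.trace_mul_comm]
  refine ⟨?_, fun ρ _ => hsame ρ, fun s s' => ?_, ?_⟩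
  · by_contra hcon
    obtain ⟨c, hc⟩ := tendsto_of_tendsto_states (F := heisenberg H L (localOp O j))
      (fun ρ hρ => by
        by_contra hno
        exact hcon ⟨ρ, hρ, hsame ρ, by
          simpa only [expectation_eq, funext (expectation_eq H L ρ (localOp O j))] using hno⟩) Y
    exact hnot c hc
  · change DecaysExponentially _
    -- Split O_j(t) - P O_k(t) P at O_k(t).
    have h := (hdiff s s').add
      (decays_sub_conj hH hunital (permOp_mul_self hπ) hP (localOp O k) s s')
    refine cast (congrArg DecaysExponentially (funext fun t => ?_)) h
    simp only [evolve_sub, Matrix.sub_apply, heisenberg]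
    ring
  · rintro ⟨X, hX⟩
    refine hnot (X * Y).trace ?_
    simp only [Matrix.trace, Matrix.diag_apply, Matrix.mul_apply]
    exact tendsto_finsetSum _ fun s _ => tendsto_finsetSum _ fun s' _ => (hX s s').mul_const _

end Synchronization

end QuantumSync

theorem corollary3 {N d : ℕ} {ι : Type*} [Fintype ι]
    (H : QuantumSync.Op N d) (L : ι → QuantumSync.Op N d) (hH : H.IsHermitian)
    (hunital : QuantumSync.liouvillian H L 1 = 0)
    (O : Matrix (Fin d) (Fin d) ℂ) (j : Fin N)
    (hosc : ∃ (A ρ : QuantumSync.Op N d) (lam : ℝ), lam ≠ 0 ∧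
      QuantumSync.IsMode H L A ρ lam ∧ (QuantumSync.localOp O j * A * ρ).trace ≠ 0) :
    (∀ (k : Fin N) (π : Equiv.Perm (Fin N)), Function.Involutive π → π j = k →
      QuantumSync.AllModesCommute H L (QuantumSync.permOp d π) →
      QuantumSync.RobustlyStablySynchronized H L O (QuantumSync.permOp d π) j k) ∧
    ((∀ i i' : Fin N, (i' : ℕ) = (i : ℕ) + 1 →
        QuantumSync.AllModesCommute H L (QuantumSync.swapOp d i i')) →
      ∀ a b : Fin N, a ≠ b →
        QuantumSync.RobustlyStablySynchronized H L O (QuantumSync.swapOp d a b) a b) := by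
  obtain ⟨A, ρ, lam, hlam, hmode, htr⟩ := hosc
  rw [mul_assoc] at htr
  have hY : QuantumSync.IsPeripheral H L (-lam) (A * ρ) :=
    QuantumSync.isPeripheral_of_liouvillian_eq hH hunital (by simpa using hmode.liouvillian_eq)
  have hswap : ∀ a b : Fin N, Function.Involutive (Equiv.swap a b) := Equiv.swap_apply_self
  refine ⟨fun k π hπ hjk hall => ?_, fun hall a b _ => ?_⟩
  · exact QuantumSync.robustlyStablySynchronized_of_commute hH hunital O hπ hjk
      (fun _ _ hZ => hall.commute hH hunital hZ) ⟨-lam, A * ρ, neg_ne_zero.mpr hlam, hY, htr⟩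
  · have hP : ∀ (π : Equiv.Perm (Fin N)) (r : ℝ) (Z : QuantumSync.Op N d),
        QuantumSync.IsPeripheral H L r Z → Commute (QuantumSync.permOp d π) Z :=
      fun π r Z hZ => QuantumSync.commute_permOp_of_neighbours
        (fun i i' hii' => (hall i i' hii').commute hH hunital hZ) π
    refine QuantumSync.robustlyStablySynchronized_of_commute hH hunital O (hswap a b)
      (Equiv.swap_apply_left a b) (hP _) ⟨-lam, A * ρ, neg_ne_zero.mpr hlam, hY, ?_⟩
    -- The overlap is only given at j; exchanging a and j carries it to a, since Y commutes with all
    -- permutations.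
    rwa [QuantumSync.trace_localOp_mul_eq (hswap a j) O (Equiv.swap_apply_left a j)
      (hP _ _ _ hY)]
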